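/- Let $n\geq 1$ be an integer and let $0<t\leq 1$ be real. Write $H_m=\sum_{j=1}^{m}\frac1j$ (so $H_0=0$). Then the series below converges absolutely and $$ \begin{aligned} \sum_{k=1}^{\infty}\frac{(-t)^kH_{k-1}}{k\binom{n+k}{k}}={}&\frac{1}{2}\log^2(t+1)+\frac{t}{t+1}\sum_{k=1}^n\frac{H_k}{k}\left(\frac{t+1}{t}\right)^k-\frac{t\log(t+1)}{t+1}\sum_{k=1}^n\frac{1}{k}\left(\frac{t+1}{t}\right)^k\\ &+\frac{\log^2(t+1)}{2(t+1)}\sum_{k=1}^n\left(\frac{t+1}{t}\right)^k\\ &+\frac{1}{t+1}\sum_{p=0}^{n-1}\left\{\sum_{k=1}^{n-p}\left(\frac{H_{p+k}-H_k}{(p+k)k}+\frac{1}{k^2(p+k)}\right)\right\}p\left(\frac{t+1}{t}\right)^p\\ &-\frac{\log(t+1)}{t+1}\sum_{k=1}^nH_k\left(\frac{t+1}{t}\right)^k . \end{aligned} $$ -/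

import Mathlib

/-!
Put `x = (t + 1) / t`, `L = log (t + 1)` and `a n j = 1 / ((j + 1) * choose (n + j + 1) (j + 1))`,
which is the beta integral `∫₀¹ u ^ j * (1 - u) ^ n du`. The series to be summed is
`f n = ∑' j, (-t) ^ (j + 1) * H_j * a n j`, and it is treated along with
`h n = ∑' j, (-t) ^ (j + 1) * a n j`. The relations `a (n + 1) j = a n j - a n (j + 1)` and
`a n (j + 1) / (j + 1) = a (n + 1) j / (n + 1)` turn into first order recurrences

  `h (n + 1) = x * h n + 1 / (n + 1)`,  `f (n + 1) = x * f n + h (n + 1) / (n + 1)`.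

For `0 < t < 1` one has `h 0 = -L` (the logarithmic series) and `f 0 = L ^ 2 / 2` (its Cauchy
square), so both recurrences can be solved explicitly (`hasSum_harmonic_mul_betaCoeff`). Since
`t / (t + 1) = 1 / x` and `1 / (t + 1) = 1 - 1 / x`, the solution is matched with the stated
expression separately at each power of `L`: at `L ^ 2` by a geometric sum, at `L` by summation by
parts, and at `L ^ 0` by comparing the coefficients of the powers of `x`
(`doubleSum_coeff_identity`).

At `t = 1` the series with `n = 0` converges only conditionally, so the recurrences do not start
there. For `n ≥ 1`, however, the terms are dominated on `[0, 1]` by those of the convergent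
telescoping series `∑ H_j / ((j + 1) * (j + 2)) = 1`; both sides are then continuous on `(0, 1]`,
and the identity extends to `t = 1`.
-/

open Finset

/-! ### Reciprocal binomial coefficients -/

/-- The number `1 / (k * choose (n + k) k)` with `k = j + 1`, which equals the beta value
`B(j + 1, n + 1)`. -/
noncomputable def betaCoeff (n j : ℕ) : ℝ :=
  1 / (((j + 1 : ℕ) : ℝ) * ((n + (j + 1)).choose (j + 1) : ℝ))

theorem betaCoeff_eq_factorial (n j : ℕ) :
    betaCoeff n j = (n.factorial : ℝ) * j.factorial / (n + j + 1).factorial := by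
  have h := Nat.add_choose_mul_factorial_mul_factorial n (j + 1)
  have h' : ((n + (j + 1)).choose (j + 1) : ℝ) * n.factorial * ((j + 1) * j.factorial)
      = (n + j + 1).factorial := by
    rw [Nat.factorial_succ j, ← Nat.add_assoc] at h
    rw [← h]
    push_cast
    rw [← Nat.add_assoc]
  have hc : ((n + (j + 1)).choose (j + 1) : ℝ) ≠ 0 := by
    have := Nat.choose_pos (show j + 1 ≤ n + (j + 1) by omega)
    positivity
  rw [betaCoeff, ← h']
  push_cast
  field_simp

theorem betaCoeff_nonneg (n j : ℕ) : 0 ≤ betaCoeff n j := by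
  unfold betaCoeff
  positivity

theorem betaCoeff_succ_left (n j : ℕ) :
    betaCoeff (n + 1) j = betaCoeff n j - betaCoeff n (j + 1) := by
  simp only [betaCoeff_eq_factorial]
  rw [show n + 1 + j + 1 = n + j + 1 + 1 by ring, show n + (j + 1) + 1 = n + j + 1 + 1 by ring,
    Nat.factorial_succ (n + j + 1), Nat.factorial_succ n, Nat.factorial_succ j]
  push_cast
  field_simp
  ring

theorem betaCoeff_succ_right_div (n j : ℕ) :
    betaCoeff n (j + 1) / (j + 1) = betaCoeff (n + 1) j / (n + 1) := by
  simp only [betaCoeff_eq_factorial]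
  rw [show n + 1 + j + 1 = n + j + 1 + 1 by ring, show n + (j + 1) + 1 = n + j + 1 + 1 by ring,
    Nat.factorial_succ n, Nat.factorial_succ j]
  push_cast
  field_simp

theorem betaCoeff_zero_right (n : ℕ) : betaCoeff n 0 = 1 / (n + 1) := by
  simp [betaCoeff]

theorem betaCoeff_zero_left (j : ℕ) : betaCoeff 0 j = 1 / (j + 1) := by
  simp [betaCoeff]

theorem betaCoeff_one_left (j : ℕ) : betaCoeff 1 j = 1 / ((j + 1) * (j + 2)) := by
  rw [betaCoeff, Nat.add_comm 1 (j + 1), Nat.choose_succ_self_right]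
  push_cast
  ring

theorem betaCoeff_le_one_left {n : ℕ} (hn : 1 ≤ n) (j : ℕ) : betaCoeff n j ≤ betaCoeff 1 j := by
  induction n, hn using Nat.le_induction with
  | base => exact le_rfl
  | succ n hn ih =>
    rw [betaCoeff_succ_left]
    linarith [betaCoeff_nonneg n (j + 1)]

theorem cast_harmonic_succ (n : ℕ) :
    ((harmonic (n + 1) : ℚ) : ℝ) = (harmonic n : ℝ) + 1 / (n + 1) := by
  rw [harmonic_succ]
  push_cast
  ring

theorem cast_harmonic_nonneg (n : ℕ) : (0 : ℝ) ≤ (harmonic n : ℝ) := by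
  induction n with
  | zero => simp
  | succ n ih => rw [cast_harmonic_succ]; positivity

/-! ### The series for `n = 0` -/

theorem hasSum_betaCoeff_zero {t : ℝ} (h0 : 0 < t) (h1 : t < 1) :
    HasSum (fun j : ℕ => (-t) ^ (j + 1) * betaCoeff 0 j) (-Real.log (t + 1)) := by
  have h := Real.hasSum_pow_div_log_of_abs_lt_one (x := -t) (by rw [abs_neg, abs_of_pos h0]; exact h1)
  rw [sub_neg_eq_add, add_comm 1 t] at h
  refine h.congr_fun ?_
  intro j
  rw [betaCoeff_zero_left]
  ring

theorem sum_antidiagonal_one_div_mul (m : ℕ) :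
    ∑ p ∈ antidiagonal m, (1 / ((p.1 : ℝ) + 1)) * (1 / ((p.2 : ℝ) + 1))
      = 2 * (harmonic (m + 1) : ℝ) / (m + 2) := by
  have hH : (harmonic (m + 1) : ℝ) = ∑ p ∈ antidiagonal m, 1 / ((p.1 : ℝ) + 1) := by
    rw [Nat.sum_antidiagonal_eq_sum_range_succ_mk, harmonic]
    push_cast
    simp
  have hH' : (harmonic (m + 1) : ℝ) = ∑ p ∈ antidiagonal m, 1 / ((p.2 : ℝ) + 1) := by
    rw [hH, ← Nat.sum_antidiagonal_swap]
    rfl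
  rw [two_mul, add_div]
  nth_rewrite 1 [hH]
  rw [hH', sum_div, sum_div, ← sum_add_distrib]
  refine sum_congr rfl fun p hp => ?_
  have : (m : ℝ) = p.1 + p.2 := by exact_mod_cast (mem_antidiagonal.1 hp).symm
  rw [this]
  field_simp
  ring

/-- The Cauchy square of the logarithmic series. -/
theorem hasSum_harmonic_mul_betaCoeff_zero {t : ℝ} (h0 : 0 < t) (h1 : t < 1) :
    HasSum (fun j : ℕ => (-t) ^ (j + 1) * (harmonic j : ℝ) * betaCoeff 0 j)
      (Real.log (t + 1) ^ 2 / 2) := by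
  have hs := hasSum_betaCoeff_zero h0 h1
  have hn := hs.summable.norm
  have hc := (summable_norm_sum_mul_antidiagonal_of_summable_norm hn hn).of_norm.hasSum
  rw [← tsum_mul_tsum_eq_tsum_sum_antidiagonal_of_summable_norm hn hn, hs.tsum_eq] at hc
  -- the term with `j = 0` vanishes because `H_0 = 0`
  rw [← hasSum_nat_add_iff' 1]
  simp only [range_one, sum_singleton, harmonic_zero, Rat.cast_zero, mul_zero, zero_mul, sub_zero]
  have h2 := hc.div_const 2
  rw [show -Real.log (t + 1) * -Real.log (t + 1) / 2 = Real.log (t + 1) ^ 2 / 2 by ring] at h2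
  refine h2.congr_fun ?_
  intro m
  have : ∑ p ∈ antidiagonal m,
      (-t) ^ (p.1 + 1) * betaCoeff 0 p.1 * ((-t) ^ (p.2 + 1) * betaCoeff 0 p.2)
      = (-t) ^ (m + 2) * (2 * (harmonic (m + 1) : ℝ) / (m + 2)) := by
    rw [← sum_antidiagonal_one_div_mul, mul_sum]
    refine sum_congr rfl fun p hp => ?_
    rw [betaCoeff_zero_left, betaCoeff_zero_left, ← mem_antidiagonal.1 hp]
    ring
  rw [this, betaCoeff_zero_left]
  push_cast
  field_simp
  ring

/-! ### Recurrences in `n` -/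

theorem HasSum.betaCoeff_succ {t s : ℝ} (ht : 0 < t) {n : ℕ}
    (h : HasSum (fun j : ℕ => (-t) ^ (j + 1) * betaCoeff n j) s) :
    HasSum (fun j : ℕ => (-t) ^ (j + 1) * betaCoeff (n + 1) j)
      ((t + 1) / t * s + 1 / (n + 1)) := by
  have h' := (hasSum_nat_add_iff' 1).2 h
  simp only [range_one, sum_singleton, betaCoeff_zero_right] at h'
  have h2 := h.add (h'.mul_left (1 / t))
  convert h2 using 1
  · funext j
    rw [betaCoeff_succ_left]
    field_simp
    ring
  · field_simp
    ring

theorem HasSum.harmonic_mul_betaCoeff_succ {t s r : ℝ} (ht : 0 < t) {n : ℕ}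
    (h : HasSum (fun j : ℕ => (-t) ^ (j + 1) * (harmonic j : ℝ) * betaCoeff n j) s)
    (hr : HasSum (fun j : ℕ => (-t) ^ (j + 1) * betaCoeff (n + 1) j) r) :
    HasSum (fun j : ℕ => (-t) ^ (j + 1) * (harmonic j : ℝ) * betaCoeff (n + 1) j)
      ((t + 1) / t * s + r / (n + 1)) := by
  have h' := (hasSum_nat_add_iff' 1).2 h
  simp only [range_one, sum_singleton, harmonic_zero, Rat.cast_zero, mul_zero, zero_mul,
    sub_zero] at h'
  have h2 := (h.add (h'.mul_left (1 / t))).add (hr.div_const ((n : ℝ) + 1))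
  convert h2 using 1
  · funext j
    rw [mul_div_assoc, ← betaCoeff_succ_right_div, betaCoeff_succ_left, cast_harmonic_succ]
    field_simp
    ring
  · field_simp

theorem hasSum_betaCoeff {t : ℝ} (h0 : 0 < t) (h1 : t < 1) (n : ℕ) :
    HasSum (fun j : ℕ => (-t) ^ (j + 1) * betaCoeff n j)
      (((t + 1) / t) ^ n * -Real.log (t + 1)
        + ∑ i ∈ range n, ((t + 1) / t) ^ i / ((n : ℝ) - i)) := by
  induction n with
  | zero => simpa using hasSum_betaCoeff_zero h0 h1
  | succ n ih =>
    convert ih.betaCoeff_succ h0 using 1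
    rw [sum_range_succ', mul_add, mul_sum, add_assoc, pow_succ]
    congr 1
    · ring
    · push_cast
      congr 1
      · refine sum_congr rfl fun i _ => ?_
        rw [add_sub_add_right_eq_sub]
        ring
      · simp

/-- Closed form of the series on the open interval. The inner coefficients are indexed by the
exponent `p` of `(t + 1) / t`. -/
theorem hasSum_harmonic_mul_betaCoeff {t : ℝ} (h0 : 0 < t) (h1 : t < 1) (n : ℕ) :
    HasSum (fun j : ℕ => (-t) ^ (j + 1) * (harmonic j : ℝ) * betaCoeff n j)
      (((t + 1) / t) ^ n * (Real.log (t + 1) ^ 2 / 2 - Real.log (t + 1) * (harmonic n : ℝ))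
        + ∑ p ∈ range n, ((harmonic n : ℝ) - (harmonic (n - p - 1) : ℝ)) / ((n : ℝ) - p)
            * ((t + 1) / t) ^ p) := by
  induction n with
  | zero => simpa using hasSum_harmonic_mul_betaCoeff_zero h0 h1
  | succ n ih =>
    convert ih.harmonic_mul_betaCoeff_succ h0 (hasSum_betaCoeff h0 h1 (n + 1)) using 1
    rw [sum_range_succ', sum_range_succ' (fun i => ((t + 1) / t) ^ i / (((n + 1 : ℕ) : ℝ) - i)),
      cast_harmonic_succ]
    have hsum : ∑ p ∈ range n, ((harmonic n : ℝ) + 1 / (n + 1)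
          - (harmonic (n + 1 - (p + 1) - 1) : ℝ)) / (((n + 1 : ℕ) : ℝ) - ((p + 1 : ℕ) : ℝ))
            * ((t + 1) / t) ^ (p + 1)
        = (t + 1) / t * (∑ p ∈ range n, ((harmonic n : ℝ) - (harmonic (n - p - 1) : ℝ))
            / ((n : ℝ) - p) * ((t + 1) / t) ^ p)
          + (∑ p ∈ range n, ((t + 1) / t) ^ (p + 1)
              / (((n + 1 : ℕ) : ℝ) - ((p + 1 : ℕ) : ℝ))) / (n + 1) := by
      rw [mul_sum, sum_div, ← sum_add_distrib]
      refine sum_congr rfl fun p _ => ?_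
      rw [Nat.add_sub_add_right]
      push_cast
      rw [add_sub_add_right_eq_sub]
      ring
    rw [hsum]
    simp only [Nat.sub_zero, Nat.add_sub_cancel, Nat.cast_zero, sub_zero, pow_zero, pow_succ]
    push_cast
    ring

/-! ### Rearranging the closed form -/

/-- The summand of the inner sum in the coefficient of `p * ((t + 1) / t) ^ p`. -/
noncomputable def doubleSumTerm (p k : ℕ) : ℝ :=
  ((harmonic (p + k) : ℝ) - (harmonic k : ℝ)) / (((p : ℝ) + (k : ℝ)) * (k : ℝ))
    + 1 / ((k : ℝ) ^ 2 * ((p : ℝ) + (k : ℝ)))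

theorem doubleSumTerm_succ (p k : ℕ) :
    doubleSumTerm p (k + 1)
      = ((harmonic (p + k + 1) : ℝ) - (harmonic k : ℝ)) / ((p + k + 1) * (k + 1)) := by
  rw [doubleSumTerm, cast_harmonic_succ k, ← add_assoc]
  push_cast
  field_simp
  ring

/-- The coefficient of `x ^ p` with `n = p + 1 + m`, by induction on `m`. -/
theorem doubleSum_coeff_identity (p m : ℕ) :
    (harmonic (p + 1) : ℝ) / (p + 1) + p * ∑ k ∈ range (m + 1), doubleSumTerm p (k + 1)
        - (p + 1) * ∑ k ∈ range m, doubleSumTerm (p + 1) (k + 1)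
      = ((harmonic (p + 1 + m) : ℝ) - (harmonic m : ℝ)) / (m + 1) := by
  induction m with
  | zero =>
    simp [doubleSumTerm_succ]
    field_simp
    ring
  | succ m ih =>
    rw [sum_range_succ _ (m + 1), sum_range_succ (fun k => doubleSumTerm (p + 1) (k + 1)) m,
      doubleSumTerm_succ p (m + 1), doubleSumTerm_succ (p + 1) m,
      show p + (m + 1) + 1 = p + 1 + m + 1 by ring, show p + 1 + (m + 1) = p + 1 + m + 1 by ring,
      cast_harmonic_succ (p + 1 + m), cast_harmonic_succ m, mul_add, mul_add]
    have e (A B : ℝ) : ((A + 1 / ((p : ℝ) + 1 + m + 1) - (B + 1 / ((m : ℝ) + 1)))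
          / ((m : ℝ) + 1 + 1))
        = (A - B) / ((m : ℝ) + 1)
          + p * ((A + 1 / ((p : ℝ) + 1 + m + 1) - (B + 1 / ((m : ℝ) + 1)))
              / (((p : ℝ) + (m + 1) + 1) * (m + 1 + 1)))
          - (p + 1) * ((A + 1 / ((p : ℝ) + 1 + m + 1) - B)
              / (((p : ℝ) + 1 + m + 1) * (m + 1))) := by
      field_simp
      ring
    push_cast
    linear_combination ih - e (harmonic (p + 1 + m) : ℝ) (harmonic m : ℝ)

theorem sum_Icc_one_eq_sum_range {M : Type*} [AddCommMonoid M] (f : ℕ → M) (n : ℕ) :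
    ∑ k ∈ Icc 1 n, f k = ∑ k ∈ range n, f (k + 1) := by
  rw [range_eq_Ico, sum_Ico_add' f 0 n 1, zero_add]
  rfl

theorem sum_doubleSum_mul_pow (n : ℕ) {x : ℝ} (hx : x ≠ 0) :
    1 / x * ∑ k ∈ Icc 1 n, (harmonic k : ℝ) / (k : ℝ) * x ^ k
      + (1 - 1 / x) * ∑ p ∈ range n, (∑ k ∈ Icc 1 (n - p), doubleSumTerm p k) * (p : ℝ) * x ^ p
      = ∑ p ∈ range n, ((harmonic n : ℝ) - (harmonic (n - p - 1) : ℝ)) / ((n : ℝ) - p)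
          * x ^ p := by
  -- the factor `1 / x` lowers the exponent; the boundary terms `p = 0` and `p = n` both vanish
  have hshift : 1 / x * ∑ p ∈ range n, (∑ k ∈ Icc 1 (n - p), doubleSumTerm p k) * (p : ℝ) * x ^ p
      = ∑ p ∈ range n, (∑ k ∈ Icc 1 (n - (p + 1)), doubleSumTerm (p + 1) k)
          * ((p + 1 : ℕ) : ℝ) * x ^ p := by
    have h1 := sum_range_succ (fun p =>
      (∑ k ∈ Icc 1 (n - p), doubleSumTerm p k) * (p : ℝ) * x ^ p) n
    rw [sum_range_succ'] at h1
    simp only [Nat.sub_self, Nat.cast_zero, mul_zero, zero_mul, add_zero] at h1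
    simp only [show Icc 1 0 = (∅ : Finset ℕ) from rfl, sum_empty, zero_mul, add_zero] at h1
    rw [← h1, mul_sum]
    refine sum_congr rfl fun p _ => ?_
    rw [pow_succ]
    field_simp
  rw [sub_mul, one_mul, hshift, sum_Icc_one_eq_sum_range, mul_sum, ← sum_sub_distrib,
    ← sum_add_distrib]
  refine sum_congr rfl fun p hp => ?_
  obtain ⟨m, rfl⟩ := Nat.exists_eq_add_of_lt (mem_range.1 hp)
  rw [show p + m + 1 - (p + 1) = m by omega, show p + m + 1 - p - 1 = m by omega,
    show p + m + 1 - p = m + 1 by omega, sum_Icc_one_eq_sum_range, sum_Icc_one_eq_sum_range]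
  have h := doubleSum_coeff_identity p m
  rw [show p + 1 + m = p + m + 1 by ring] at h
  rw [show ((p + m + 1 : ℕ) : ℝ) - p = m + 1 by push_cast; ring, ← h, pow_succ]
  push_cast
  field_simp
  ring

theorem sum_harmonic_mul_pow (n : ℕ) {x : ℝ} (hx : x ≠ 0) :
    1 / x * ∑ k ∈ Icc 1 n, 1 / (k : ℝ) * x ^ k
      + (1 - 1 / x) * ∑ k ∈ Icc 1 n, (harmonic k : ℝ) * x ^ k = (harmonic n : ℝ) * x ^ n := by
  rw [sum_Icc_one_eq_sum_range, sum_Icc_one_eq_sum_range]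
  induction n with
  | zero => simp
  | succ n ih =>
    rw [sum_range_succ, sum_range_succ, mul_add, mul_add, add_add_add_comm, ih,
      cast_harmonic_succ]
    push_cast
    field_simp
    ring

theorem sum_pow_Icc_one (n : ℕ) {x : ℝ} (hx : x ≠ 0) :
    (1 - 1 / x) * ∑ k ∈ Icc 1 n, x ^ k = x ^ n - 1 := by
  rw [sum_Icc_one_eq_sum_range]
  induction n with
  | zero => simp
  | succ n ih =>
    rw [sum_range_succ, mul_add, ih]
    field_simp
    ring

/-- The closed form in the arrangement with prefactors `t / (t + 1)` and `1 / (t + 1)`. -/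
noncomputable def closedForm (n : ℕ) (t : ℝ) : ℝ :=
  1 / 2 * Real.log (t + 1) ^ 2
    + t / (t + 1) * ∑ k ∈ Icc 1 n, (harmonic k : ℝ) / (k : ℝ) * ((t + 1) / t) ^ k
    - t * Real.log (t + 1) / (t + 1) * ∑ k ∈ Icc 1 n, 1 / (k : ℝ) * ((t + 1) / t) ^ k
    + Real.log (t + 1) ^ 2 / (2 * (t + 1)) * ∑ k ∈ Icc 1 n, ((t + 1) / t) ^ k
    + 1 / (t + 1) * ∑ p ∈ range n,
        (∑ k ∈ Icc 1 (n - p), doubleSumTerm p k) * (p : ℝ) * ((t + 1) / t) ^ p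
    - Real.log (t + 1) / (t + 1) * ∑ k ∈ Icc 1 n, (harmonic k : ℝ) * ((t + 1) / t) ^ k

theorem closedForm_eq (n : ℕ) {t : ℝ} (ht : 0 < t) :
    closedForm n t
      = ((t + 1) / t) ^ n * (Real.log (t + 1) ^ 2 / 2 - Real.log (t + 1) * (harmonic n : ℝ))
        + ∑ p ∈ range n, ((harmonic n : ℝ) - (harmonic (n - p - 1) : ℝ)) / ((n : ℝ) - p)
            * ((t + 1) / t) ^ p := by
  have hx : (t + 1) / t ≠ 0 := by positivity
  have e0 := sum_doubleSum_mul_pow n hx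
  have e1 := sum_harmonic_mul_pow n hx
  have e2 := sum_pow_Icc_one n hx
  have i1 : 1 / ((t + 1) / t) = t / (t + 1) := one_div_div _ _
  have i2 : 1 - t / (t + 1) = 1 / (t + 1) := by field_simp; ring
  rw [i1, i2] at e0 e1 e2
  have i3 : Real.log (t + 1) ^ 2 / (2 * (t + 1))
      = Real.log (t + 1) ^ 2 / 2 * (1 / (t + 1)) := by field_simp
  rw [closedForm, ← e0, i3]
  linear_combination (-Real.log (t + 1)) * e1 + Real.log (t + 1) ^ 2 / 2 * e2

/-! ### The endpoint `t = 1` -/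

theorem summable_harmonic_mul_betaCoeff_one :
    Summable (fun j : ℕ => (harmonic j : ℝ) * betaCoeff 1 j) := by
  refine summable_of_sum_range_le (c := 1)
    (fun j => mul_nonneg (cast_harmonic_nonneg j) (betaCoeff_nonneg 1 j)) fun N => ?_
  have h : ∑ j ∈ range N, (harmonic j : ℝ) * betaCoeff 1 j
      = 1 - ((harmonic N : ℝ) + 1) / (N + 1) := by
    induction N with
    | zero => simp
    | succ N ih =>
      rw [sum_range_succ, ih, betaCoeff_one_left, cast_harmonic_succ]
      push_cast
      field_simp
      ring
  rw [h]
  have := cast_harmonic_nonneg N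
  have : 0 ≤ ((harmonic N : ℝ) + 1) / (N + 1) := by positivity
  linarith

theorem norm_harmonic_mul_betaCoeff_le {n : ℕ} (hn : 1 ≤ n) {t : ℝ} (h0 : 0 ≤ t) (h1 : t ≤ 1)
    (j : ℕ) : ‖(-t) ^ (j + 1) * (harmonic j : ℝ) * betaCoeff n j‖
      ≤ (harmonic j : ℝ) * betaCoeff 1 j := by
  have hH := cast_harmonic_nonneg j
  have hb := betaCoeff_nonneg n j
  rw [norm_mul, norm_mul, norm_pow, norm_neg, Real.norm_of_nonneg h0, Real.norm_of_nonneg hH,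
    Real.norm_of_nonneg hb]
  refine mul_le_mul ?_ (betaCoeff_le_one_left hn j) hb hH
  exact mul_le_of_le_one_left hH (pow_le_one₀ h0 h1)

theorem continuousOn_closedForm (n : ℕ) : ContinuousOn (closedForm n) (Set.Ioi 0) := by
  intro t ht
  have ht' : (0 : ℝ) < t := ht
  have h1 : t ≠ 0 := ht'.ne'
  have h2 : t + 1 ≠ 0 := by positivity
  have h3 : 2 * (t + 1) ≠ 0 := by positivity
  refine ContinuousAt.continuousWithinAt ?_
  unfold closedForm
  fun_prop (disch := assumption)

theorem tsum_harmonic_mul_betaCoeff {n : ℕ} (hn : 1 ≤ n) {t : ℝ} (h0 : 0 < t) (h1 : t ≤ 1) :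
    ∑' j : ℕ, (-t) ^ (j + 1) * (harmonic j : ℝ) * betaCoeff n j = closedForm n t := by
  have hcont : ContinuousOn
      (fun t : ℝ => ∑' j : ℕ, (-t) ^ (j + 1) * (harmonic j : ℝ) * betaCoeff n j)
      (Set.Ioc 0 1) :=
    continuousOn_tsum (fun j => by fun_prop) summable_harmonic_mul_betaCoeff_one
      fun j t ht => norm_harmonic_mul_betaCoeff_le hn ht.1.le ht.2 j
  have heq : Set.EqOn
      (fun t : ℝ => ∑' j : ℕ, (-t) ^ (j + 1) * (harmonic j : ℝ) * betaCoeff n j)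
      (closedForm n) (Set.Ioo 0 1) := fun t ht =>
    (hasSum_harmonic_mul_betaCoeff ht.1 ht.2 n).tsum_eq.trans (closedForm_eq n ht.1).symm
  refine heq.of_subset_closure hcont
    ((continuousOn_closedForm n).mono fun t ht => ht.1) Set.Ioo_subset_Ioc_self ?_ ⟨h0, h1⟩
  rw [closure_Ioo zero_ne_one]
  exact Set.Ioc_subset_Icc_self

theorem theorem2p15 (n : ℕ) (hn : 1 ≤ n) (t : ℝ) (ht0 : 0 < t) (ht1 : t ≤ 1) :
    HasSum
      (fun j : ℕ => (-t) ^ (j + 1) * (harmonic ((j + 1) - 1) : ℝ) /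
        (((j + 1 : ℕ) : ℝ) * ((n + (j + 1)).choose (j + 1) : ℝ)))
      (1 / 2 * Real.log (t + 1) ^ 2
        + t / (t + 1) * ∑ k ∈ Finset.Icc 1 n, (harmonic k : ℝ) / (k : ℝ) * ((t + 1) / t) ^ k
        - t * Real.log (t + 1) / (t + 1) *
            ∑ k ∈ Finset.Icc 1 n, 1 / (k : ℝ) * ((t + 1) / t) ^ k
        + Real.log (t + 1) ^ 2 / (2 * (t + 1)) * ∑ k ∈ Finset.Icc 1 n, ((t + 1) / t) ^ k
        + 1 / (t + 1) * ∑ p ∈ Finset.range n,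
            (∑ k ∈ Finset.Icc 1 (n - p),
              (((harmonic (p + k) : ℝ) - (harmonic k : ℝ)) / (((p : ℝ) + (k : ℝ)) * (k : ℝ))
                + 1 / ((k : ℝ) ^ 2 * ((p : ℝ) + (k : ℝ)))))
              * (p : ℝ) * ((t + 1) / t) ^ p
        - Real.log (t + 1) / (t + 1) *
            ∑ k ∈ Finset.Icc 1 n, (harmonic k : ℝ) * ((t + 1) / t) ^ k) := by
  have hs := (Summable.of_norm_bounded summable_harmonic_mul_betaCoeff_one
    (norm_harmonic_mul_betaCoeff_le hn ht0.le ht1)).hasSum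
  rw [tsum_harmonic_mul_betaCoeff hn ht0 ht1] at hs
  refine hs.congr_fun ?_
  intro j
  rw [betaCoeff, Nat.add_sub_cancel, mul_one_div]
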